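/- Let $R$ be a commutative local Artinian Gorenstein ring. For $R$-modules $A$ and $X$ the trace module of $A$ in $X$ is the submodule $\sum_{\alpha\in\operatorname{Hom}_R(A,X)}\alpha(A)$ of $X$; a submodule $N\subseteq X$ is a proper trace module in $X$ if $N\neq X$ and $N$ is the trace module in $X$ of some $R$-module $A$. For an $R$-module $N$ and $n\ge 1$ let $\Omega^0N=N$, let $\Omega^nN$ be the kernel of a projective cover of $\Omega^{n-1}N$, and let $\Omega^{-n}N$ be the cokernel of an injective hull of $\Omega^{-(n-1)}N$ (all defined up to isomorphism); these modules are the (positive and negative) syzygies of $N$. An $R$-module $M$ is rigid if $\operatorname{Ext}^1_R(M,M)=0$. If $N$ is a proper trace module in some $R$-module $X$, and $M\cong\Omega^nN$ for some $n\in\mathbb{Z}$ with $M\neq 0$, then $\operatorname{Ext}^1_R(M,M)\neq 0$. In particular, if $M\cong\Omega^nI$ for an ideal $I$ of $R$ with $0\neq I\neq R$ and some $n\in\mathbb{Z}$, then $M$ is not rigid. -/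

import Mathlib

universe u

open CategoryTheory

/-- A Noetherian local ring is Gorenstein if it has finite injective dimension as a module
over itself. -/
def IsGorensteinLocalRing (R : Type u) [CommRing R] [IsLocalRing R] [IsNoetherianRing R] : Prop :=
  ∃ d : ℕ, HasInjectiveDimensionLE (ModuleCat.of R R) d

/-- The trace module of `A` in `X`: the sum of the images `α(A)` over all `R`-linear maps
`α : A → X`. -/
def traceModule (R : Type u) [CommRing R] (A X : Type u) [AddCommGroup A] [Module R A]
    [AddCommGroup X] [Module R X] : Submodule R X :=
  ⨆ α : A →ₗ[R] X, LinearMap.range α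

/-- A submodule `N` of `X` is a proper trace module in `X` if it is the trace module in `X` of
some `R`-module, and `N ≠ X`. -/
def IsProperTraceModule {R : Type u} [CommRing R] {X : Type u} [AddCommGroup X] [Module R X]
    (N : Submodule R X) : Prop :=
  (∃ (A : Type u) (_ : AddCommGroup A) (_ : Module R A), N = traceModule R A X) ∧ N ≠ ⊤

/-- An `R`-module `M` is rigid if `Ext¹_R(M, M) = 0`. -/
def IsRigidModule (R : Type u) [CommRing R] (M : Type u) [AddCommGroup M] [Module R M] : Prop :=
  Subsingleton (Abelian.Ext (ModuleCat.of R M) (ModuleCat.of R M) 1)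

/-- `π : P → N` is a projective cover: `P` is projective and `π` is surjective with superfluous
kernel. -/
def IsProjectiveCover {R : Type u} [CommRing R] {P N : Type u} [AddCommGroup P] [Module R P]
    [AddCommGroup N] [Module R N] (π : P →ₗ[R] N) : Prop :=
  Module.Projective R P ∧ Function.Surjective π ∧
    ∀ L : Submodule R P, L ⊔ LinearMap.ker π = ⊤ → L = ⊤

/-- `ι : N → E` is an injective hull: `E` is injective and `ι` is injective with essential
image. -/
def IsInjectiveHull {R : Type u} [CommRing R] {N E : Type u} [AddCommGroup N] [Module R N]
    [AddCommGroup E] [Module R E] (ι : N →ₗ[R] E) : Prop :=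
  Module.Injective R E ∧ Function.Injective ι ∧
    ∀ L : Submodule R E, L ⊓ LinearMap.range ι = ⊥ → L = ⊥

/-- `M` is (isomorphic to) the first syzygy `Ω N`, the kernel of a projective cover of `N`. -/
def IsFirstSyzygy (R : Type u) [CommRing R] (N M : Type u) [AddCommGroup N] [Module R N]
    [AddCommGroup M] [Module R M] : Prop :=
  ∃ (P : Type u) (_ : AddCommGroup P) (_ : Module R P) (π : P →ₗ[R] N),
    IsProjectiveCover π ∧ Nonempty (M ≃ₗ[R] LinearMap.ker π)

/-- `M` is (isomorphic to) the first cosyzygy `Ω⁻¹ N`, the cokernel of an injective hull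
of `N`. -/
def IsFirstCosyzygy (R : Type u) [CommRing R] (N M : Type u) [AddCommGroup N] [Module R N]
    [AddCommGroup M] [Module R M] : Prop :=
  ∃ (E : Type u) (_ : AddCommGroup E) (_ : Module R E) (ι : N →ₗ[R] E),
    IsInjectiveHull ι ∧ Nonempty (M ≃ₗ[R] E ⧸ LinearMap.range ι)

/-- `M ≅ Ωⁿ N` for a natural number `n`. -/
def IsNatSyzygy (R : Type u) [CommRing R] (N : Type u) [AddCommGroup N] [Module R N] :
    ℕ → ∀ (M : Type u) [AddCommGroup M] [Module R M], Prop
  | 0, M, _, _ => Nonempty (M ≃ₗ[R] N)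
  | n + 1, M, _, _ => ∃ (K : Type u) (_ : AddCommGroup K) (_ : Module R K),
      IsNatSyzygy R N n K ∧ IsFirstSyzygy R K M

/-- `M ≅ Ω⁻ⁿ N` for a natural number `n`. -/
def IsNatCosyzygy (R : Type u) [CommRing R] (N : Type u) [AddCommGroup N] [Module R N] :
    ℕ → ∀ (M : Type u) [AddCommGroup M] [Module R M], Prop
  | 0, M, _, _ => Nonempty (M ≃ₗ[R] N)
  | n + 1, M, _, _ => ∃ (K : Type u) (_ : AddCommGroup K) (_ : Module R K),
      IsNatCosyzygy R N n K ∧ IsFirstCosyzygy R K M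

/-- `M ≅ Ωⁿ N` for an integer `n`. -/
def IsSyzygy (R : Type u) [CommRing R] (n : ℤ) (N M : Type u) [AddCommGroup N] [Module R N]
    [AddCommGroup M] [Module R M] : Prop :=
  match n with
  | Int.ofNat k => IsNatSyzygy R N k M
  | Int.negSucc k => IsNatCosyzygy R N (k + 1) M

/-! If N is a trace module in X, every map N → X lands in N, so Hom(N, X) → Hom(N, X/N) is zero and
the long exact sequence embeds Hom(N, X/N) in Ext¹(N, N). For N nonzero and proper, the composite N
→ k → X/N through the residue field k is nonzero (`exists_linearMap_ne_zero`), so N is not rigid.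

An Artinian Gorenstein local ring is self-injective (`IsGorensteinLocalRing.injective_self`), so
projective and injective modules coincide, with no finiteness condition. Dimension shifting
(`ext_one_subsingleton_X₃`, `ext_one_subsingleton_X₁`) then carries rigidity of any syzygy or
cosyzygy back to N. Self-injectivity also makes each ideal its own trace in R. -/

/-! ### Socles and maps through the residue field. -/

section LocalArtinian

open IsLocalRing

variable {R : Type u} [CommRing R] [IsLocalRing R]

/-- A nonzero element killed by a power of the maximal ideal has a nonzero multiple killed by the
maximal ideal. -/
lemma exists_smul_ne_zero_of_pow_smul_eq_zero {M : Type u} [AddCommGroup M] [Module R M]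
    (n : ℕ) (x : M) (hx : x ≠ 0) (h : ∀ a ∈ maximalIdeal R ^ n, a • x = 0) :
    ∃ r : R, r • x ≠ 0 ∧ ∀ a ∈ maximalIdeal R, a • r • x = 0 := by
  induction n with
  | zero => exact absurd (by simpa using h 1 (by simp)) hx
  | succ n ih =>
    by_cases hn : ∀ a ∈ maximalIdeal R ^ n, a • x = 0
    · exact ih hn
    · push Not at hn
      obtain ⟨r, hr, hrx⟩ := hn
      refine ⟨r, hrx, fun a ha => ?_⟩
      rw [smul_smul]
      exact h _ (by rw [pow_succ']; exact Ideal.mul_mem_mul ha hr)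

lemma IsArtinianRing.exists_maximalIdeal_pow_eq_bot [IsArtinianRing R] :
    ∃ n : ℕ, maximalIdeal R ^ n = ⊥ :=
  (isArtinianRing_iff_isNilpotent_maximalIdeal R).mp ‹_›

lemma exists_smul_ne_zero_socle [IsArtinianRing R] {M : Type u} [AddCommGroup M] [Module R M]
    (x : M) (hx : x ≠ 0) : ∃ r : R, r • x ≠ 0 ∧ ∀ a ∈ maximalIdeal R, a • r • x = 0 := by
  obtain ⟨n, hn⟩ := IsArtinianRing.exists_maximalIdeal_pow_eq_bot (R := R)
  refine exists_smul_ne_zero_of_pow_smul_eq_zero n x hx fun a ha => ?_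
  rw [hn, Ideal.mem_bot] at ha
  rw [ha, zero_smul]

variable (R) in
lemma exists_ne_zero_socle_ring [IsArtinianRing R] :
    ∃ s : R, s ≠ 0 ∧ ∀ a ∈ maximalIdeal R, a * s = 0 := by
  obtain ⟨r, hr, h⟩ := exists_smul_ne_zero_socle (R := R) (1 : R) one_ne_zero
  exact ⟨r • 1, hr, by simpa using h⟩

/-- The map `R ⧸ 𝔪 → M` sending `1` to an element killed by the maximal ideal. -/
def residueToModule {M : Type u} [AddCommGroup M] [Module R M] (y : M)
    (hy : ∀ a ∈ maximalIdeal R, a • y = 0) : (R ⧸ maximalIdeal R) →ₗ[R] M :=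
  (maximalIdeal R).liftQ (LinearMap.toSpanSingleton R M y) fun a ha => by simpa using hy a ha

@[simp]
lemma residueToModule_mk {M : Type u} [AddCommGroup M] [Module R M] (y : M)
    (hy : ∀ a ∈ maximalIdeal R, a • y = 0) (r : R) :
    residueToModule y hy (Ideal.Quotient.mk _ r) = r • y := rfl

lemma smul_eq_zero_iff_mem_maximalIdeal {M : Type u} [AddCommGroup M] [Module R M] {y : M}
    (h0 : y ≠ 0) (hy : ∀ a ∈ maximalIdeal R, a • y = 0) (r : R) :
    r • y = 0 ↔ r ∈ maximalIdeal R := by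
  refine ⟨fun h => ?_, hy r⟩
  by_contra hr
  have hu : IsUnit r := by simpa using hr
  exact h0 ((hu.smul_eq_zero).mp h)

lemma residueToModule_injective {M : Type u} [AddCommGroup M] [Module R M] {y : M}
    (h0 : y ≠ 0) (hy : ∀ a ∈ maximalIdeal R, a • y = 0) :
    Function.Injective (residueToModule y hy) := by
  rw [injective_iff_map_eq_zero]
  intro a ha
  obtain ⟨r, rfl⟩ := Ideal.Quotient.mk_surjective a
  rw [residueToModule_mk, smul_eq_zero_iff_mem_maximalIdeal h0 hy] at ha
  exact Ideal.Quotient.eq_zero_iff_mem.mpr ha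

/-- A module killed by the maximal ideal of an Artinian local ring embeds in a free module. -/
lemma exists_injective_finsupp_of_isTorsionBySet [IsArtinianRing R] {V : Type u} [AddCommGroup V]
    [Module R V] (hV : Module.IsTorsionBySet R V (maximalIdeal R)) :
    ∃ (J : Type u) (f : V →ₗ[R] J →₀ R), Function.Injective f := by
  obtain ⟨s, hs0, hs⟩ := exists_ne_zero_socle_ring R
  let := Ideal.Quotient.field (maximalIdeal R)
  let : Module (R ⧸ maximalIdeal R) V := hV.module
  let b := Module.Free.chooseBasis (R ⧸ maximalIdeal R) V
  refine ⟨_, (Finsupp.mapRange.linearMap (residueToModule s hs)) ∘ₗ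
    b.repr.toLinearMap.restrictScalars R, ?_⟩
  rw [LinearMap.coe_comp]
  refine Function.Injective.comp ?_ b.repr.injective
  exact Finsupp.mapRange_injective _ (map_zero _) (residueToModule_injective hs0 hs)

/-- A nonzero module over an Artinian local ring maps nontrivially onto the residue field. -/
lemma exists_ne_zero_to_residue [IsArtinianRing R] {M : Type u} [AddCommGroup M] [Module R M]
    [Nontrivial M] : ∃ f : M →ₗ[R] (R ⧸ maximalIdeal R), f ≠ 0 := by
  let := Ideal.Quotient.field (maximalIdeal R)
  let V := M ⧸ (maximalIdeal R • ⊤ : Submodule R M)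
  -- Nakayama without finite generation: 𝔪M = M would give M = 𝔪ⁿM = 0, as 𝔪 is nilpotent.
  have hV : (maximalIdeal R • ⊤ : Submodule R M) ≠ ⊤ := by
    intro h
    obtain ⟨n, hn⟩ := IsArtinianRing.exists_maximalIdeal_pow_eq_bot (R := R)
    have key : ∀ k : ℕ, (maximalIdeal R ^ k • ⊤ : Submodule R M) = ⊤ := by
      intro k
      induction k with
      | zero => simp
      | succ k ih => rw [pow_succ, Submodule.mul_smul, h, ih]
    have := key n
    rw [hn, Submodule.bot_smul] at this
    exact bot_ne_top this
  have : Nontrivial V := Submodule.Quotient.nontrivial_iff.mpr hV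
  obtain ⟨v, hv⟩ := exists_ne (0 : V)
  obtain ⟨f, hf⟩ : ∃ f : Module.Dual (R ⧸ maximalIdeal R) V, f v ≠ 0 := by
    by_contra! h
    exact hv ((Module.forall_dual_apply_eq_zero_iff _ v).mp h)
  obtain ⟨m, rfl⟩ := Submodule.mkQ_surjective _ v
  exact ⟨f.restrictScalars R ∘ₗ Submodule.mkQ _, fun h => hf (DFunLike.congr_fun h m)⟩

lemma exists_linearMap_ne_zero [IsArtinianRing R] (M N : Type u) [AddCommGroup M] [Module R M]
    [AddCommGroup N] [Module R N] [Nontrivial M] [Nontrivial N] : ∃ f : M →ₗ[R] N, f ≠ 0 := by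
  obtain ⟨y, hy⟩ := exists_ne (0 : N)
  obtain ⟨r, hr, h⟩ := exists_smul_ne_zero_socle (R := R) y hy
  obtain ⟨f, hf⟩ := exists_ne_zero_to_residue (R := R) (M := M)
  refine ⟨residueToModule _ h ∘ₗ f, fun h0 => hf ?_⟩
  ext x
  exact residueToModule_injective hr h (by simpa using DFunLike.congr_fun h0 x)

end LocalArtinian

/-! ### Projective equals injective over a self-injective ring. -/

section Injective

open IsLocalRing

/-- Over a Noetherian self-injective ring, free modules are injective. -/
lemma Module.Injective.finsupp_self {R : Type u} [CommRing R] [IsNoetherianRing R]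
    [Module.Injective R R] (J : Type u) : Module.Injective R (J →₀ R) := by
  classical
  refine Module.Baer.injective fun I g => ?_
  have hR : ∀ j : J, ∃ c : R, ∀ x : I, g x j = (x : R) * c := fun j => by
    obtain ⟨h, hh⟩ := Module.Baer.of_injective (R := R) (Q := R) ‹_› I (Finsupp.lapply j ∘ₗ g)
    refine ⟨h 1, fun x => ?_⟩
    have := hh x x.2
    rw [LinearMap.comp_apply, Finsupp.lapply_apply] at this
    rw [← smul_eq_mul, ← map_smul, smul_eq_mul, mul_one]
    exact this.symm
  choose c hc using hR
  -- Finite generation of I confines g to finitely many coordinates, so the multipliers `c j` with j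
  -- in S form a finitely supported vector.
  obtain ⟨S, hS⟩ : ∃ S : Finset J, ∀ x : I, (g x).support ⊆ S := by
    obtain ⟨t, ht⟩ := (Module.Finite.fg_top : (⊤ : Submodule R I).FG)
    refine ⟨t.biUnion fun x => (g x).support, fun x => ?_⟩
    have hx : x ∈ Submodule.span R (t : Set I) := ht ▸ Submodule.mem_top
    have : Submodule.span R (t : Set I) ≤
        (Finsupp.supported R R ((t.biUnion fun x => (g x).support : Finset J) : Set J)).comap g := by
      refine Submodule.span_le.mpr fun y hy => ?_
      rw [SetLike.mem_coe, Submodule.mem_comap, Finsupp.mem_supported]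
      exact_mod_cast Finset.subset_biUnion_of_mem (fun x => (g x).support) hy
    exact_mod_cast (Finsupp.mem_supported R _).mp (this hx)
  refine ⟨LinearMap.toSpanSingleton R _ (Finsupp.onFinset S (fun j => if j ∈ S then c j else 0)
    fun j hj => by by_contra h; simp [h] at hj), fun x hx => ?_⟩
  ext j
  rw [LinearMap.toSpanSingleton_apply, Finsupp.smul_apply, Finsupp.onFinset_apply, smul_eq_mul]
  split_ifs with hj
  · exact (hc j ⟨x, hx⟩).symm
  · rw [mul_zero]
    by_contra hne
    exact hj (hS ⟨x, hx⟩ (Finsupp.mem_support_iff.mpr (Ne.symm hne)))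

/-- Over a Noetherian self-injective ring, projective modules are injective. -/
lemma Module.Injective.of_projective_of_self {R : Type u} [CommRing R] [IsNoetherianRing R]
    [Module.Injective R R] (P : Type u) [AddCommGroup P] [Module R P] [Module.Projective R P] :
    Module.Injective R P := by
  obtain ⟨s, hs⟩ := Module.projective_def'.mp ‹Module.Projective R P›
  have := Module.Injective.finsupp_self (R := R) P
  refine ⟨fun X Y _ _ _ _ f hf g => ?_⟩
  obtain ⟨h, hh⟩ := Module.Injective.out f hf (s ∘ₗ g)
  refine ⟨Finsupp.linearCombination R id ∘ₗ h, fun x => ?_⟩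
  rw [LinearMap.comp_apply, hh]
  exact DFunLike.congr_fun hs (g x)

/-- Over a self-injective Artinian local ring, injective modules are projective. -/
lemma Module.Projective.of_injective_of_self {R : Type u} [CommRing R] [IsLocalRing R]
    [IsArtinianRing R] [Module.Injective R R] (E : Type u) [AddCommGroup E] [Module R E]
    [Module.Injective R E] : Module.Projective R E := by
  classical
  obtain ⟨s, hs0, hs⟩ := exists_ne_zero_socle_ring R
  let := Ideal.Quotient.field (maximalIdeal R)
  let S := Submodule.torsionBySet R E (maximalIdeal R)
  have hS : ∀ x : S, ∀ a ∈ maximalIdeal R, a • (x : E) = 0 := fun x a ha =>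
    (Submodule.mem_torsionBySet_iff _ _).mp x.2 ⟨a, ha⟩
  let : Module (R ⧸ maximalIdeal R) S :=
    (Submodule.torsionBySet_isTorsionBySet (M := E) (maximalIdeal R : Set R)).module
  have mk_smul : ∀ (r : R) (x : S), Ideal.Quotient.mk (maximalIdeal R) r • x = r • x :=
    fun _ _ => rfl
  let b := Module.Free.chooseBasis (R ⧸ maximalIdeal R) S
  -- Extend the map k → E, 1 ↦ b j, along the embedding k → R, 1 ↦ s, and evaluate at 1.
  have hx : ∀ j, ∃ x : E, s • x = b j := fun j => by
    obtain ⟨h, hh⟩ := Module.Injective.extension_property R E _ _ (residueToModule s hs)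
      (residueToModule_injective hs0 hs) (residueToModule (b j : E) (hS _))
    refine ⟨h 1, ?_⟩
    have := DFunLike.congr_fun hh (Ideal.Quotient.mk _ 1)
    rw [LinearMap.comp_apply, residueToModule_mk, residueToModule_mk, one_smul, one_smul] at this
    rw [← map_smul, smul_eq_mul, mul_one, this]
  choose x hx using hx
  -- By self-injectivity the socle of R is generated by s.
  have hsoc : ∀ t : R, (∀ a ∈ maximalIdeal R, a * t = 0) → ∃ r : R, t = r * s := fun t ht => by
    obtain ⟨h, hh⟩ := Module.Injective.extension_property R R _ _ (residueToModule s hs)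
      (residueToModule_injective hs0 hs) (residueToModule t ht)
    refine ⟨h 1, ?_⟩
    have := DFunLike.congr_fun hh (Ideal.Quotient.mk _ 1)
    rw [LinearMap.comp_apply, residueToModule_mk, residueToModule_mk, one_smul, one_smul] at this
    rw [← this, mul_comm, ← smul_eq_mul, ← map_smul, smul_eq_mul, mul_one]
  let φ : (Module.Free.ChooseBasisIndex (R ⧸ maximalIdeal R) S →₀ R) →ₗ[R] E :=
    Finsupp.linearCombination R x
  -- Injectivity can be tested on the socle, where φ sends s times the j-th unit vector to b j.
  have hφ : Function.Injective φ := by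
    rw [injective_iff_map_eq_zero]
    intro w hw
    by_contra hw0
    obtain ⟨r, hr, hrw⟩ := exists_smul_ne_zero_socle (R := R) w hw0
    have hv : φ (r • w) = 0 := by rw [map_smul, hw, smul_zero]
    generalize r • w = v at hr hrw hv
    have : ∀ j, ∃ c : R, v j = c * s := fun j =>
      hsoc _ fun a ha => by simpa using DFunLike.congr_fun (hrw a ha) j
    choose c hc using this
    have hsum : ∑ j ∈ v.support, Ideal.Quotient.mk (maximalIdeal R) (c j) • b j = 0 := by
      apply Subtype.ext
      simp only [mk_smul]
      rw [Submodule.coe_sum, ZeroMemClass.coe_zero, ← hv]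
      refine Finset.sum_congr rfl fun j _ => ?_
      rw [Submodule.coe_smul, hc, ← hx, smul_smul]
      rfl
    refine hr (Finsupp.ext fun j => ?_)
    by_cases hj : j ∈ v.support
    · have := linearIndependent_iff'.mp b.linearIndependent _ _ hsum j hj
      rw [Finsupp.zero_apply, hc]
      exact hs _ (Ideal.Quotient.eq_zero_iff_mem.mp this)
    · simpa using hj
  have := Module.Injective.finsupp_self (R := R)
    (Module.Free.ChooseBasisIndex (R ⧸ maximalIdeal R) S)
  obtain ⟨g, hg⟩ := Module.Injective.extension_property R _ _ _ φ hφ LinearMap.id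
  -- The retraction g is injective because the socle of E already lies in the range of φ, where g
  -- inverts φ. Hence E is free.
  have hginj : Function.Injective g := by
    rw [injective_iff_map_eq_zero]
    intro y hy
    by_contra hy0
    obtain ⟨r, hr, hry⟩ := exists_smul_ne_zero_socle (R := R) y hy0
    have hgy : g (r • y) = 0 := by rw [map_smul, hy, smul_zero]
    generalize r • y = z at hr hry hgy
    have hz : z ∈ LinearMap.range φ := by
      have hzS : z ∈ S := (Submodule.mem_torsionBySet_iff _ _).mpr fun a => hry a a.2
      have hle : ∀ q ∈ Submodule.span (R ⧸ maximalIdeal R) (Set.range b),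
          (q : E) ∈ LinearMap.range φ := by
        intro q hq
        induction hq using Submodule.span_induction with
        | mem q hq =>
          obtain ⟨j, rfl⟩ := hq
          exact ⟨Finsupp.single j s, by
            rw [← hx]; exact Finsupp.linearCombination_single R s j⟩
        | zero => exact Submodule.zero_mem _
        | add p q _ _ hp hq => exact Submodule.add_mem _ hp hq
        | smul a q _ hq =>
          obtain ⟨a, rfl⟩ := Ideal.Quotient.mk_surjective a
          exact Submodule.smul_mem _ a hq
      exact hle ⟨z, hzS⟩ (b.span_eq ▸ Submodule.mem_top)
    obtain ⟨v, rfl⟩ := hz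
    have : v = 0 := by rw [← hgy]; exact (DFunLike.congr_fun hg v).symm
    exact hr (by rw [this, map_zero])
  have hgφ : Function.Surjective g := fun v => ⟨φ v, DFunLike.congr_fun hg v⟩
  exact Module.Projective.of_equiv (LinearEquiv.ofBijective g ⟨hginj, hgφ⟩).symm

end Injective

/-! ### From finite injective dimension to self-injectivity. -/

section SelfInjective

open IsLocalRing Abelian

variable {R : Type u} [CommRing R] [IsLocalRing R] [IsArtinianRing R]

/-- Embed V in a free module F: Extⁿ⁺¹(V, R) sits between Extⁿ⁺¹(F, R) = 0 and Extⁿ⁺²(F/V, R) = 0.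
-/
lemma ext_self_subsingleton_of_isTorsionBySet (n : ℕ)
    [HasInjectiveDimensionLT (ModuleCat.of R R) (n + 2)] (V : Type u) [AddCommGroup V] [Module R V]
    (hV : Module.IsTorsionBySet R V (maximalIdeal R)) :
    Subsingleton (Ext (ModuleCat.of R V) (ModuleCat.of R R) (n + 1)) := by
  obtain ⟨J, f, hf⟩ := exists_injective_finsupp_of_isTorsionBySet hV
  let T : ShortComplex (ModuleCat.{u} R) :=
    ModuleCat.shortComplexOfCompEqZero f (LinearMap.range f).mkQ (LinearMap.range_mkQ_comp f)
  have hT : T.ShortExact := ModuleCat.shortComplex_shortExact T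
    (LinearMap.exact_map_mkQ_range f) hf (Submodule.mkQ_surjective _)
  have : Projective (ModuleCat.of R (J →₀ R)) :=
    (IsProjective.iff_projective (R := R) (J →₀ R)).mp inferInstance
  refine subsingleton_of_forall_eq 0 fun e => ?_
  obtain ⟨y, hy⟩ := Ext.contravariant_sequence_exact₁ hT _ (x₁ := e) (n₁ := n + 2) (by omega)
    (Ext.eq_zero_of_hasInjectiveDimensionLT _ (n + 2) le_rfl)
  have hy0 : y = 0 := Ext.eq_zero_of_projective (P := ModuleCat.of R (J →₀ R)) y
  rw [← hy, hy0, Ext.comp_zero]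

/-- Dévissage along 0 → 𝔪Y → Y → Y/𝔪Y → 0. Nilpotency of 𝔪 makes it apply to every Y, which lowers
the injective dimension of R by one. -/
lemma ext_self_subsingleton_of_pow_smul_eq_bot (n : ℕ)
    [HasInjectiveDimensionLT (ModuleCat.of R R) (n + 2)] (i : ℕ) (Y : Type u) [AddCommGroup Y]
    [Module R Y] (hY : (maximalIdeal R ^ i • ⊤ : Submodule R Y) = ⊥) :
    Subsingleton (Ext (ModuleCat.of R Y) (ModuleCat.of R R) (n + 1)) := by
  induction i generalizing Y with
  | zero =>
    have : Subsingleton Y := by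
      rw [← Submodule.subsingleton_iff R, ← subsingleton_iff_bot_eq_top]
      simpa using hY.symm
    have : Projective (ModuleCat.of R Y) := (IsProjective.iff_projective (R := R) Y).mp inferInstance
    exact subsingleton_of_forall_eq 0 Ext.eq_zero_of_projective
  | succ i ih =>
    let L : Submodule R Y := maximalIdeal R • ⊤
    have h1 : Subsingleton (Ext (ModuleCat.of R L) (ModuleCat.of R R) (n + 1)) := by
      refine ih L ?_
      apply Submodule.map_injective_of_injective L.injective_subtype
      rw [Submodule.map_smul'', Submodule.map_top, Submodule.range_subtype, Submodule.map_bot,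
        ← hY, pow_succ, Submodule.mul_smul]
    have h2 := ext_self_subsingleton_of_isTorsionBySet n (Y ⧸ L)
      (Module.isTorsionBySet_quotient_ideal_smul Y (maximalIdeal R))
    let T : ShortComplex (ModuleCat.{u} R) :=
      ModuleCat.shortComplexOfCompEqZero L.subtype L.mkQ (by ext; simp)
    have hT : T.ShortExact := ModuleCat.shortComplex_shortExact T
      (LinearMap.exact_subtype_mkQ L) L.injective_subtype L.mkQ_surjective
    refine subsingleton_of_forall_eq 0 fun e => ?_
    obtain ⟨y, hy⟩ := Ext.contravariant_sequence_exact₂ hT _ (x₂ := e) (h1.elim _ _)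
    rw [← hy, h2.elim y 0, Ext.comp_zero]

/-- An Artinian Gorenstein local ring is self-injective. -/
theorem IsGorensteinLocalRing.injective_self (hR : IsGorensteinLocalRing R) :
    Module.Injective R R := by
  obtain ⟨d, hd⟩ := hR
  rw [Module.injective_iff_injective_object]
  rw [injective_iff_hasInjectiveDimensionLT_one]
  induction d with
  | zero => exact hd
  | succ n ih =>
    refine ih (hasInjectiveDimensionLT_of_enoughProjectives _ _ fun Y => ?_)
    obtain ⟨i, hi⟩ := IsArtinianRing.exists_maximalIdeal_pow_eq_bot (R := R)
    exact ext_self_subsingleton_of_pow_smul_eq_bot n i Y (by rw [hi, Submodule.bot_smul])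

end SelfInjective

/-! ### Dimension shifting for self-extensions. -/

section Ext

open Abelian

variable {R : Type u} [CommRing R]

lemma IsRigidModule.of_linearEquiv {M N : Type u} [AddCommGroup M] [Module R M] [AddCommGroup N]
    [Module R N] (e : M ≃ₗ[R] N) (hM : IsRigidModule R M) : IsRigidModule R N := by
  let i := e.toModuleIso
  refine subsingleton_of_forall_eq 0 fun x => ?_
  have h : ((Ext.mk₀ i.hom).comp x (zero_add 1)).comp (Ext.mk₀ i.inv) (add_zero 1) = 0 :=
    hM.elim _ _
  have h' := congrArg (fun y => ((Ext.mk₀ i.inv).comp y (zero_add 1)).comp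
    (Ext.mk₀ i.hom) (add_zero 1)) h
  simpa using h'

/-- Dimension shifting for self-extensions along a short exact sequence whose middle term is
projective and injective: rigidity passes from the kernel to the cokernel. -/
lemma ext_one_subsingleton_X₃ {S : ShortComplex (ModuleCat.{u} R)} (hS : S.ShortExact)
    [Projective S.X₂] [Injective S.X₂] (h : Subsingleton (Ext S.X₁ S.X₁ 1)) :
    Subsingleton (Ext S.X₃ S.X₃ 1) := by
  refine subsingleton_of_forall_eq 0 fun x => ?_
  -- The image of x in Ext²(X₃, X₁) comes from Ext¹(X₁, X₁) = 0, so x lifts to Ext¹(X₃, X₂) = 0.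
  obtain ⟨y, hy⟩ := Ext.contravariant_sequence_exact₃ hS _ (x.comp hS.extClass (rfl : 1 + 1 = 2))
    (Ext.eq_zero_of_projective _) (n₀ := 1) rfl
  obtain ⟨z, hz⟩ := Ext.covariant_sequence_exact₃ _ hS x (rfl : 1 + 1 = 2)
    (by rw [← hy, h.elim y 0, Ext.comp_zero])
  rw [← hz, Ext.eq_zero_of_injective z, Ext.zero_comp]

/-- Dimension shifting for self-extensions along a short exact sequence whose middle term is
projective and injective: rigidity passes from the cokernel to the kernel. -/
lemma ext_one_subsingleton_X₁ {S : ShortComplex (ModuleCat.{u} R)} (hS : S.ShortExact)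
    [Projective S.X₂] [Injective S.X₂] (h : Subsingleton (Ext S.X₃ S.X₃ 1)) :
    Subsingleton (Ext S.X₁ S.X₁ 1) := by
  refine subsingleton_of_forall_eq 0 fun x => ?_
  obtain ⟨y, hy⟩ := Ext.covariant_sequence_exact₁ _ hS (hS.extClass.comp x (rfl : 1 + 1 = 2))
    (Ext.eq_zero_of_injective _) (n₀ := 1) rfl
  obtain ⟨z, hz⟩ := Ext.contravariant_sequence_exact₁ hS _ x (rfl : 1 + 1 = 2)
    (by rw [← hy, h.elim y 0, Ext.zero_comp])
  rw [← hz, Ext.eq_zero_of_projective z, Ext.comp_zero]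

end Ext

/-! ### Descent of rigidity from syzygies. -/

section Syzygy

open Abelian

variable {R : Type u} [CommRing R] [IsArtinianRing R] [Module.Injective R R]

lemma IsFirstSyzygy.isRigidModule {N M : Type u} [AddCommGroup N] [Module R N] [AddCommGroup M]
    [Module R M] (h : IsFirstSyzygy R N M) (hM : IsRigidModule R M) : IsRigidModule R N := by
  obtain ⟨P, _, _, π, ⟨hP, hsurj, -⟩, ⟨e⟩⟩ := h
  have hT := LinearMap.shortExact_shortComplexKer hsurj
  have : Projective π.shortComplexKer.X₂ := (IsProjective.iff_projective (R := R) P).mp hP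
  have : Injective π.shortComplexKer.X₂ := (Module.injective_iff_injective_object R P).mp
    (Module.Injective.of_projective_of_self P)
  exact ext_one_subsingleton_X₃ hT (hM.of_linearEquiv e)

lemma IsNatSyzygy.isRigidModule {N M : Type u} [AddCommGroup N] [Module R N] [AddCommGroup M]
    [Module R M] {n : ℕ} (h : IsNatSyzygy R N n M) (hM : IsRigidModule R M) :
    IsRigidModule R N := by
  induction n generalizing M with
  | zero => exact hM.of_linearEquiv h.some
  | succ n ih =>
    obtain ⟨K, _, _, hK, hKM⟩ := h
    exact ih hK (hKM.isRigidModule hM)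

variable [IsLocalRing R]

lemma IsFirstCosyzygy.isRigidModule {N M : Type u} [AddCommGroup N] [Module R N] [AddCommGroup M]
    [Module R M] (h : IsFirstCosyzygy R N M) (hM : IsRigidModule R M) : IsRigidModule R N := by
  obtain ⟨E, _, _, ι, ⟨hE, hinj, -⟩, ⟨e⟩⟩ := h
  let T : ShortComplex (ModuleCat.{u} R) :=
    ModuleCat.shortComplexOfCompEqZero ι (LinearMap.range ι).mkQ (LinearMap.range_mkQ_comp ι)
  have hT : T.ShortExact := ModuleCat.shortComplex_shortExact T
    (LinearMap.exact_map_mkQ_range ι) hinj (Submodule.mkQ_surjective _)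
  have : Projective T.X₂ := (IsProjective.iff_projective (R := R) E).mp
    (Module.Projective.of_injective_of_self E)
  have : Injective T.X₂ := (Module.injective_iff_injective_object R E).mp hE
  exact ext_one_subsingleton_X₁ hT (hM.of_linearEquiv e)

lemma IsNatCosyzygy.isRigidModule {N M : Type u} [AddCommGroup N] [Module R N] [AddCommGroup M]
    [Module R M] {n : ℕ} (h : IsNatCosyzygy R N n M) (hM : IsRigidModule R M) :
    IsRigidModule R N := by
  induction n generalizing M with
  | zero => exact hM.of_linearEquiv h.some
  | succ n ih =>
    obtain ⟨K, _, _, hK, hKM⟩ := h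
    exact ih hK (hKM.isRigidModule hM)

/-- Over a self-injective Artinian local ring, a module with a rigid syzygy is rigid. -/
lemma IsSyzygy.isRigidModule {N M : Type u} [AddCommGroup N] [Module R N] [AddCommGroup M]
    [Module R M] {n : ℤ} (h : IsSyzygy R n N M) (hM : IsRigidModule R M) :
    IsRigidModule R N := by
  cases n with
  | ofNat k => exact IsNatSyzygy.isRigidModule h hM
  | negSucc k => exact IsNatCosyzygy.isRigidModule h hM

end Syzygy

/-! ### Syzygies of the zero module. -/

section Subsingleton

variable {R : Type u} [CommRing R]

lemma IsFirstSyzygy.subsingleton {N M : Type u} [AddCommGroup N] [Module R N] [AddCommGroup M]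
    [Module R M] (h : IsFirstSyzygy R N M) [Subsingleton N] : Subsingleton M := by
  obtain ⟨P, _, _, π, ⟨-, -, hπ⟩, ⟨e⟩⟩ := h
  have hker : LinearMap.ker π = ⊤ := by ext; simp [Subsingleton.elim _ (0 : N)]
  have : Subsingleton P := by
    rw [← Submodule.subsingleton_iff R, ← subsingleton_iff_bot_eq_top]
    exact hπ ⊥ (by rw [hker, bot_sup_eq])
  exact e.injective.subsingleton

lemma IsFirstCosyzygy.subsingleton {N M : Type u} [AddCommGroup N] [Module R N] [AddCommGroup M]
    [Module R M] (h : IsFirstCosyzygy R N M) [Subsingleton N] : Subsingleton M := by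
  obtain ⟨E, _, _, ι, ⟨-, -, hι⟩, ⟨e⟩⟩ := h
  have hrange : LinearMap.range ι = ⊥ := by
    rw [LinearMap.range_eq_bot]
    ext x
    rw [Subsingleton.elim x 0, map_zero, map_zero]
  have : Subsingleton E := by
    rw [← Submodule.subsingleton_iff R, ← subsingleton_iff_bot_eq_top]
    exact (hι ⊤ (by rw [hrange, inf_bot_eq])).symm
  exact e.injective.subsingleton

/-- Minimality of covers and hulls matters here: it forces N ≠ 0 when M ≠ 0. -/
lemma IsSyzygy.subsingleton {N M : Type u} [AddCommGroup N] [Module R N] [AddCommGroup M]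
    [Module R M] {n : ℤ} (h : IsSyzygy R n N M) [Subsingleton N] : Subsingleton M := by
  have hnat : ∀ (n : ℕ) (M : Type u) [AddCommGroup M] [Module R M],
      IsNatSyzygy R N n M → Subsingleton M := by
    intro n
    induction n with
    | zero => exact fun M _ _ h => h.some.injective.subsingleton
    | succ n ih =>
      rintro M _ _ ⟨K, _, _, hK, hKM⟩
      have := ih K hK
      exact hKM.subsingleton
  have hconat : ∀ (n : ℕ) (M : Type u) [AddCommGroup M] [Module R M],
      IsNatCosyzygy R N n M → Subsingleton M := by
    intro n
    induction n with
    | zero => exact fun M _ _ h => h.some.injective.subsingleton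
    | succ n ih =>
      rintro M _ _ ⟨K, _, _, hK, hKM⟩
      have := ih K hK
      exact hKM.subsingleton
  cases n with
  | ofNat k => exact hnat k M h
  | negSucc k => exact hconat (k + 1) M h

end Subsingleton

/-! ### Trace modules and their self-extensions. -/

section Trace

open Abelian

variable {R : Type u} [CommRing R]

/-- Every map from a trace module in `X` to `X` has image in the trace module. -/
lemma range_le_traceModule (A X : Type u) [AddCommGroup A] [Module R A] [AddCommGroup X]
    [Module R X] (f : traceModule R A X →ₗ[R] X) : LinearMap.range f ≤ traceModule R A X := by
  have hle : ∀ α : A →ₗ[R] X, LinearMap.range α ≤ traceModule R A X :=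
    fun α => le_iSup (fun α : A →ₗ[R] X => LinearMap.range α) α
  -- The trace is spanned by the images of A, and f restricted to each of them is again induced by a
  -- map A → X.
  have htop : (⨆ α : A →ₗ[R] X, (LinearMap.range α).comap (traceModule R A X).subtype) = ⊤ := by
    apply Submodule.map_injective_of_injective (traceModule R A X).injective_subtype
    rw [Submodule.map_iSup, Submodule.map_top, Submodule.range_subtype]
    simp only [Submodule.map_comap_subtype]
    exact iSup_congr fun α => inf_eq_right.mpr (hle α)
  rw [LinearMap.range_eq_map, ← htop, Submodule.map_iSup]
  refine iSup_le fun α => ?_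
  rintro _ ⟨y, ⟨a, ha⟩, rfl⟩
  have : f y = (f ∘ₗ α.codRestrict _ fun a => hle α ⟨a, rfl⟩) a :=
    congrArg f (Subtype.ext ha.symm)
  rw [this]
  exact hle _ ⟨a, rfl⟩

lemma IsProperTraceModule.range_le {X : Type u} [AddCommGroup X] [Module R X]
    {N : Submodule R X} (hN : IsProperTraceModule N) (f : N →ₗ[R] X) : LinearMap.range f ≤ N := by
  obtain ⟨⟨A, _, _, rfl⟩, -⟩ := hN
  exact range_le_traceModule A X f

/-- A nonzero proper trace module over an Artinian local ring is not rigid. -/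
theorem IsProperTraceModule.not_isRigidModule [IsLocalRing R] [IsArtinianRing R] {X : Type u}
    [AddCommGroup X] [Module R X] {N : Submodule R X} (hN : IsProperTraceModule N)
    [Nontrivial N] : ¬ IsRigidModule R N := by
  intro h
  have : Nontrivial (X ⧸ N) := Submodule.Quotient.nontrivial_iff.mpr hN.2
  obtain ⟨φ, hφ⟩ := exists_linearMap_ne_zero (R := R) N (X ⧸ N)
  let T : ShortComplex (ModuleCat.{u} R) :=
    ModuleCat.shortComplexOfCompEqZero N.subtype N.mkQ (by ext; simp)
  have hT : T.ShortExact := ModuleCat.shortComplex_shortExact T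
    (LinearMap.exact_subtype_mkQ N) N.injective_subtype N.mkQ_surjective
  -- Rigidity kills the image of φ in Ext¹(N, N), so φ lifts to ψ : N → X; as ψ lands in N, φ = 0.
  obtain ⟨y, hy⟩ := Ext.covariant_sequence_exact₃ (ModuleCat.of R N) hT
    (Ext.mk₀ (ModuleCat.ofHom φ)) (zero_add 1) (h.elim _ _)
  obtain ⟨ψ, rfl⟩ := Ext.homEquiv₀.symm.surjective y
  have hψ : ψ ≫ T.g = ModuleCat.ofHom φ := Ext.homEquiv₀.symm.injective (by simpa using hy)
  refine hφ (LinearMap.ext fun n => ?_)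
  have h1 : φ n = N.mkQ (ψ.hom n) := congrArg (fun f => f.hom n) hψ.symm
  rw [h1, LinearMap.zero_apply, Submodule.mkQ_apply, Submodule.Quotient.mk_eq_zero]
  exact hN.range_le ψ.hom ⟨n, rfl⟩

/-- Proper ideals of a self-injective ring are proper trace modules. -/
lemma Ideal.isProperTraceModule [Module.Injective R R] (I : Ideal R) (hI : I ≠ ⊤) :
    IsProperTraceModule (X := R) I := by
  refine ⟨⟨I, inferInstance, inferInstance, le_antisymm ?_ (iSup_le fun α => ?_)⟩, hI⟩
  · refine le_trans ?_ (le_iSup _ (Submodule.subtype I))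
    rw [Submodule.range_subtype]
  · rintro _ ⟨x, rfl⟩
    -- Every map I → R extends to R, hence is multiplication by an element and preserves I.
    obtain ⟨g, hg⟩ := Module.Baer.of_injective (R := R) (Q := R) ‹_› I α
    rw [← hg x x.2, ← mul_one (x : R), ← smul_eq_mul, map_smul, smul_eq_mul]
    exact I.mul_mem_right _ x.2

end Trace

theorem theorem3 (R : Type u) [CommRing R] [IsLocalRing R] [IsArtinianRing R]
    (hR : IsGorensteinLocalRing R) :
    (∀ (X : Type u) [AddCommGroup X] [Module R X] (N : Submodule R X),
      IsProperTraceModule N →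
      ∀ (n : ℤ) (M : Type u) [AddCommGroup M] [Module R M],
        IsSyzygy R n N M → Nontrivial M →
        Nontrivial (Abelian.Ext (ModuleCat.of R M) (ModuleCat.of R M) 1)) ∧
    (∀ I : Ideal R, I ≠ ⊥ → I ≠ ⊤ →
      ∀ (n : ℤ) (M : Type u) [AddCommGroup M] [Module R M],
        IsSyzygy R n I M → ¬ IsRigidModule R M) := by
  have := hR.injective_self
  refine ⟨fun X _ _ N hN n M _ _ hM _ => ?_, fun I hI hI' n M _ _ hM h => ?_⟩
  · by_contra hn
    have hsub : ¬ Subsingleton N := fun _ => not_subsingleton M hM.subsingleton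
    have := not_subsingleton_iff_nontrivial.mp hsub
    exact hN.not_isRigidModule (hM.isRigidModule (not_nontrivial_iff_subsingleton.mp hn))
  -- M ≠ 0 need not be assumed: rigidity of M, even of M = 0, would pass to the nonzero I.
  · have : Nontrivial I := Submodule.nontrivial_iff_ne_bot.mpr hI
    exact (I.isProperTraceModule hI').not_isRigidModule (hM.isRigidModule h)
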